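/- Let $X,Y$ be compact metric spaces, $c:X\times Y\to[0,+\infty)$ a continuous function, and $\mu,\nu$ Borel probability measures on $X$ and $Y$ respectively. Let $\Gamma(\mu,\nu)$ be the set of Borel probability measures on $X\times Y$ with marginals $\mu$ and $\nu$, and set $$T_c(\mu,\nu):=\inf\Big\{\int_{X\times Y}c\,d\gamma\ :\ \gamma\in\Gamma(\mu,\nu)\Big\},\qquad \mathcal F_c:=\{(\varphi,\psi)\in C^0(X)\times C^0(Y)\ :\ \varphi(x)+\psi(y)\le c(x,y)\ \ \forall (x,y)\in X\times Y\}.$$ For $\varphi\in C^0(X)$ and $\psi\in C^0(Y)$ write $\varphi^c(y):=\inf_{x\in X}\,(c(x,y)-\varphi(x))$ and $\psi^c(x):=\inf_{y\in Y}\,(c(x,y)-\psi(y))$; a pair $(\varphi,\psi)\in\mathcal F_c$ is called a pair of $c$-concave conjugate functions if $\psi=\varphi^c$ and $\varphi=\psi^c$. Then the infimum defining $T_c(\mu,\nu)$ is attained, and $$T_c(\mu,\nu)=\sup\Big\{\int_X\varphi\,d\mu+\int_Y\psi\,d\nu\ :\ (\varphi,\psi)\in\mathcal F_c\Big\}.$$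 Moreover, the supremum is attained by a pair $(\bar\varphi,\bar\psi)$ of $c$-concave conjugate functions such that, for every $\bar\gamma\in\Gamma(\mu,\nu)$ with $\int c\,d\bar\gamma=T_c(\mu,\nu)$, one has $\bar\varphi(x)+\bar\psi(y)=c(x,y)$ for $\bar\gamma$-almost every $(x,y)$. -/

import Mathlib

open MeasureTheory

noncomputable section

namespace OptimalTransport

/-- The set `Γ(μ, ν)` of transport plans: probability measures on `X × Y` with
marginals `μ` and `ν`. -/
def plans {X Y : Type*} [MeasurableSpace X] [MeasurableSpace Y]
    (μ : ProbabilityMeasure X) (ν : ProbabilityMeasure Y) : Set (ProbabilityMeasure (X × Y)) :=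
  {γ | (γ : Measure (X × Y)).map Prod.fst = (μ : Measure X) ∧
    (γ : Measure (X × Y)).map Prod.snd = (ν : Measure Y)}

/-- The total cost `∫ c(x,y) γ(dxdy)` of a plan. -/
def planCost {X Y : Type*} [MeasurableSpace X] [MeasurableSpace Y]
    (c : X × Y → ℝ) (γ : ProbabilityMeasure (X × Y)) : ℝ :=
  ∫ p, c p ∂(γ : Measure (X × Y))

/-- The Monge–Kantorovich value `T_c(μ, ν)`. -/
def transportCost {X Y : Type*} [MeasurableSpace X] [MeasurableSpace Y]
    (c : X × Y → ℝ) (μ : ProbabilityMeasure X) (ν : ProbabilityMeasure Y) : ℝ :=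
  sInf (planCost c '' plans μ ν)

/-- `γ` is an optimal plan: it belongs to `Γ(μ, ν)` and realizes the infimum. -/
def IsOptimalPlan {X Y : Type*} [MeasurableSpace X] [MeasurableSpace Y]
    (c : X × Y → ℝ) (μ : ProbabilityMeasure X) (ν : ProbabilityMeasure Y)
    (γ : ProbabilityMeasure (X × Y)) : Prop :=
  γ ∈ plans μ ν ∧ planCost c γ = transportCost c μ ν

/-- The class `F_c` of pairs of continuous functions with `φ(x) + ψ(y) ≤ c(x,y)`. -/
def admissiblePairs {X Y : Type*} [TopologicalSpace X] [TopologicalSpace Y]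
    (c : X × Y → ℝ) : Set (C(X, ℝ) × C(Y, ℝ)) :=
  {p | ∀ x y, p.1 x + p.2 y ≤ c (x, y)}

/-- The dual objective `∫ φ dμ + ∫ ψ dν`. -/
def dualValue {X Y : Type*} [TopologicalSpace X] [TopologicalSpace Y]
    [MeasurableSpace X] [MeasurableSpace Y]
    (μ : ProbabilityMeasure X) (ν : ProbabilityMeasure Y) (p : C(X, ℝ) × C(Y, ℝ)) : ℝ :=
  (∫ x, p.1 x ∂(μ : Measure X)) + ∫ y, p.2 y ∂(ν : Measure Y)

/-- The c-transform `φᶜ(y) = inf_x (c(x,y) - φ(x))` of a function on `X`. -/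
def cTransform {X Y : Type*} (c : X × Y → ℝ) (φ : X → ℝ) (y : Y) : ℝ :=
  ⨅ x, (c (x, y) - φ x)

/-- The symmetric c-transform `ψᶜ(x) = inf_y (c(x,y) - ψ(y))` of a function on `Y`. -/
def cTransform' {X Y : Type*} (c : X × Y → ℝ) (ψ : Y → ℝ) (x : X) : ℝ :=
  ⨅ y, (c (x, y) - ψ y)

/-- A pair of c-concave conjugate functions: an element of `F_c` with `ψ = φᶜ` and `φ = ψᶜ`. -/
def IsConjugatePair {X Y : Type*} [TopologicalSpace X] [TopologicalSpace Y]
    (c : X × Y → ℝ) (p : C(X, ℝ) × C(Y, ℝ)) : Prop :=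
  p ∈ admissiblePairs c ∧ (∀ y, p.2 y = cTransform c p.1 y) ∧ (∀ x, p.1 x = cTransform' c p.2 x)

end OptimalTransport

end

/-!
For every cost `c`, the dual problem is solved by a pair of conjugate functions: replacing `φ` by
`ψᶜ` and `ψ` by `φᶜ` does not decrease the dual value, `ψᶜ` inherits the modulus of continuity of
`c`, and after subtracting a constant the Arzelà–Ascoli theorem applies. The optimal dual value
`D c` is therefore a superlinear function of `c`, and Hahn–Banach gives a linear functional
`Λ ≥ D` on `C(X × Y, ℝ)` which touches `D` at the given cost. Such a `Λ` is positive and agrees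
with the dual value on the functions `φ(x) + ψ(y)`, so the measure representing it is a transport
plan, of cost `D c`. By weak duality this plan is optimal, and the extremality relation is the
equality case of weak duality.
-/

open scoped CompactlySupported

namespace OptimalTransport

section ContinuousFunctions

variable {X α E : Type*} [TopologicalSpace X] [PseudoMetricSpace E]

theorem equicontinuous_setOf_dist_le [PseudoMetricSpace α] (F : C(X, E)) :
    {f : X → α | ∀ x x', dist (f x) (f x') ≤ dist (F x) (F x')}.Equicontinuous := fun x =>
  Metric.equicontinuousAt_of_continuity_modulus (fun x' => dist (F x) (F x'))
    ((continuous_const.dist F.continuous).tendsto' x 0 (dist_self _)) _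
    (.of_forall fun x' f => f.2 x x')

theorem isCompact_setOf_apply_eq_and_dist_le [MetricSpace α] [ProperSpace α] (F : C(X, E))
    (x₀ : X) (a : α) :
    IsCompact {φ : C(X, α) | φ x₀ = a ∧ ∀ x x', dist (φ x) (φ x') ≤ dist (F x) (F x')} := by
  set S := {φ : C(X, α) | φ x₀ = a ∧ ∀ x x', dist (φ x) (φ x') ≤ dist (F x) (F x')}
  have image_eq : ContinuousMap.toFun '' S =
      {f | f x₀ = a ∧ ∀ x x', dist (f x) (f x') ≤ dist (F x) (F x')} := by
    ext f
    refine ⟨?_, fun hf =>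
      ⟨⟨f, (equicontinuous_setOf_dist_le F).continuous_of_mem hf.2⟩, hf, rfl⟩⟩
    rintro ⟨φ, hφ, rfl⟩
    exact hφ
  have isClosed_image : IsClosed (ContinuousMap.toFun '' S) := by
    simp only [image_eq, Set.ofPred_and, Set.ofPred_forall]
    exact (isClosed_eq (by fun_prop) (by fun_prop)).inter
      (isClosed_iInter fun x => isClosed_iInter fun x' => isClosed_le (by fun_prop) (by fun_prop))
  have image_subset : ContinuousMap.toFun '' S ⊆
      Set.univ.pi fun x => Metric.closedBall a (dist (F x) (F x₀)) := by
    rintro _ ⟨φ, ⟨hφa, hφ⟩, rfl⟩ x -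
    exact hφa ▸ hφ x x₀
  refine ArzelaAscoli.isCompact_of_equicontinuous S ?_ ?_
  · exact (isCompact_univ_pi fun x => isCompact_closedBall _ _).of_isClosed_subset
      isClosed_image image_subset
  · exact (equicontinuous_setOf_dist_le F).comp fun φ : S => ⟨φ.1, φ.2.2⟩

theorem lipschitzWith_one_iInf [CompactSpace X] :
    LipschitzWith 1 fun f : C(X, ℝ) => ⨅ x, f x := by
  refine LipschitzWith.of_le_add fun f g => ?_
  cases isEmpty_or_nonempty X
  · simp [Real.iInf_of_isEmpty]
  · rw [← sub_le_iff_le_add]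
    refine le_ciInf fun x => ?_
    have hfx : ⨅ x, f x ≤ f x := ciInf_le (isCompact_range f.continuous).bddBelow x
    have hfg : f x - g x ≤ dist f g := (le_abs_self _).trans (f.dist_apply_le_dist x)
    linarith

end ContinuousFunctions

theorem exists_linearMap_le_sublinear_apply_eq {E : Type*} [AddCommGroup E] [Module ℝ E]
    (N : E → ℝ) (N_hom : ∀ t : ℝ, 0 < t → ∀ x, N (t • x) = t * N x)
    (N_add : ∀ x y, N (x + y) ≤ N x + N y) (x : E) :
    ∃ g : E →ₗ[ℝ] ℝ, (∀ y, g y ≤ N y) ∧ g x = N x := by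
  have N_zero : N 0 = 0 := by
    have := N_hom 2 two_pos 0
    rw [smul_zero] at this
    linarith
  have mul_le (t : ℝ) : t * N x ≤ N (t • x) := by
    rcases lt_trichotomy t 0 with ht | rfl | ht
    · have := N_add (t • x) (-t • x)
      rw [N_hom _ (neg_pos.2 ht), neg_smul, add_neg_cancel, N_zero] at this
      linarith
    · simp [N_zero]
    · exact (N_hom t ht x).ge
  let f : E →ₗ.[ℝ] ℝ := LinearPMap.mkSpanSingleton' x (N x) fun t ht => by
    rcases smul_eq_zero.1 ht with rfl | rfl <;> simp [N_zero]
  have f_le (y : f.domain) : f y ≤ N y := by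
    obtain ⟨y, hy⟩ := y
    obtain ⟨t, rfl⟩ := Submodule.mem_span_singleton.1 hy
    exact (LinearPMap.mkSpanSingleton'_apply x (N x) _ t hy).trans_le (mul_le t)
  obtain ⟨g, hgf, hgN⟩ := exists_extension_of_le_sublinear f N N_hom N_add f_le
  have hx : x ∈ f.domain := Submodule.mem_span_singleton_self x
  exact ⟨g, hgN, (hgf ⟨x, hx⟩).trans (LinearPMap.mkSpanSingleton'_apply_self x _ _ hx)⟩

section Integrals

variable {Z : Type*} [TopologicalSpace Z] [CompactSpace Z] [MeasurableSpace Z]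

theorem integrable_continuousMap [OpensMeasurableSpace Z] (m : Measure Z) [IsFiniteMeasure m]
    (f : C(Z, ℝ)) : Integrable f m :=
  (BoundedContinuousFunction.mkOfCompact f).integrable m

theorem integrable_continuousMap_comp [OpensMeasurableSpace Z] {Ω : Type*} [MeasurableSpace Ω]
    (m : Measure Ω) [IsFiniteMeasure m] (f : C(Z, ℝ)) {g : Ω → Z} (hg : Measurable g) :
    Integrable (fun ω => f (g ω)) m :=
  (integrable_continuousMap (m.map g) f).comp_measurable hg

theorem isBoundedLinearMap_integral [OpensMeasurableSpace Z] (m : Measure Z) [IsFiniteMeasure m] :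
    IsBoundedLinearMap ℝ fun f : C(Z, ℝ) => ∫ z, f z ∂m :=
  IsLinearMap.with_bound
    ⟨fun f g => integral_add (integrable_continuousMap m f) (integrable_continuousMap m g),
      fun t f => integral_const_mul t f⟩
    (m.real Set.univ) fun f => mul_comm ‖f‖ _ ▸
      norm_integral_le_of_norm_le_const (.of_forall f.norm_coe_le_norm)

theorem exists_probabilityMeasure_integral_eq [T2Space Z] [BorelSpace Z] (Λ : C(Z, ℝ) →ₗ[ℝ] ℝ)
    (map_nonneg : ∀ f, 0 ≤ f → 0 ≤ Λ f) (map_one : Λ 1 = 1) :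
    ∃ γ : ProbabilityMeasure Z, ∀ f : C(Z, ℝ), ∫ z, f z ∂(γ : Measure Z) = Λ f := by
  let Λc : C_c(Z, ℝ) →ₚ[ℝ] ℝ := PositiveLinearMap.mk₀
    { toFun f := Λ f.toContinuousMap
      map_add' f g := Λ.map_add f.toContinuousMap g.toContinuousMap
      map_smul' t f := Λ.map_smul t f.toContinuousMap } fun f hf => map_nonneg _ hf
  have integral_eq (f : C(Z, ℝ)) : ∫ z, f z ∂(RealRMK.rieszMeasure Λc) = Λ f :=
    RealRMK.integral_rieszMeasure Λc (CompactlySupportedContinuousMap.continuousMapEquiv f)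
  have measure_univ : RealRMK.rieszMeasure Λc Set.univ = 1 := by
    simpa [map_one, Measure.real, ENNReal.toReal_eq_one_iff] using integral_eq 1
  exact ⟨⟨RealRMK.rieszMeasure Λc, ⟨measure_univ⟩⟩, integral_eq⟩

end Integrals

section CTransform

variable {X Y : Type*} [TopologicalSpace X] [TopologicalSpace Y]

theorem mem_admissiblePairs_comp_prodSwap_iff {c : C(X × Y, ℝ)} {φ : C(X, ℝ)} {ψ : C(Y, ℝ)} :
    (ψ, φ) ∈ admissiblePairs (c.comp .prodSwap) ↔ (φ, ψ) ∈ admissiblePairs c :=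
  forall_comm.trans <| forall₂_congr fun x y => by rw [add_comm]; rfl

variable [CompactSpace X] (c : C(X × Y, ℝ))

/-- The c-transform `φᶜ` of a continuous function, as a continuous function. The transform `ψᶜ` of
a function on `Y` is obtained by applying it to the cost `c.comp .prodSwap` on `Y × X`. -/
noncomputable def cTransformMap (φ : C(X, ℝ)) : C(Y, ℝ) where
  toFun := cTransform c φ
  continuous_toFun := lipschitzWith_one_iInf.continuous.comp
    ((c.comp .prodSwap).curry.continuous.sub continuous_const)

theorem dist_cTransformMap_apply_le (φ : C(X, ℝ)) (y y' : Y) :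
    dist (cTransformMap c φ y) (cTransformMap c φ y') ≤
      dist ((c.comp .prodSwap).curry y) ((c.comp .prodSwap).curry y') :=
  (lipschitzWith_one_iInf.dist_le_mul ((c.comp .prodSwap).curry y - φ)
    ((c.comp .prodSwap).curry y' - φ)).trans_eq (by rw [NNReal.coe_one, one_mul, dist_sub_right])

theorem lipschitzWith_one_cTransformMap [CompactSpace Y] : LipschitzWith 1 (cTransformMap c) :=
  LipschitzWith.mk_one fun φ φ' => (ContinuousMap.dist_le dist_nonneg).2 fun y =>
    (lipschitzWith_one_iInf.dist_le_mul ((c.comp .prodSwap).curry y - φ)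
      ((c.comp .prodSwap).curry y - φ')).trans_eq (by rw [NNReal.coe_one, one_mul, dist_sub_left])

variable {c}

theorem mem_admissiblePairs_iff_le_cTransformMap [Nonempty X] {φ : C(X, ℝ)} {ψ : C(Y, ℝ)} :
    (φ, ψ) ∈ admissiblePairs c ↔ ψ ≤ cTransformMap c φ := by
  have hbdd (y : Y) : BddBelow (Set.range fun x => c (x, y) - φ x) :=
    (isCompact_range (by fun_prop)).bddBelow
  have hle (y : Y) : ψ y ≤ cTransformMap c φ y ↔ ∀ x, ψ y ≤ c (x, y) - φ x := le_ciInf_iff (hbdd y)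
  simp only [ContinuousMap.le_def, hle, le_sub_iff_add_le']
  exact forall_comm

variable [Nonempty X] [CompactSpace Y] [Nonempty Y]

variable (c) in
theorem gc_cTransformMap :
    GaloisConnection (OrderDual.toDual ∘ cTransformMap c)
      (cTransformMap (c.comp .prodSwap) ∘ OrderDual.ofDual) := fun _ _ =>
  mem_admissiblePairs_iff_le_cTransformMap.symm.trans <|
    mem_admissiblePairs_comp_prodSwap_iff.symm.trans mem_admissiblePairs_iff_le_cTransformMap

theorem mem_admissiblePairs_iff_le_cTransformMap_prodSwap {φ : C(X, ℝ)} {ψ : C(Y, ℝ)} :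
    (φ, ψ) ∈ admissiblePairs c ↔ φ ≤ cTransformMap (c.comp .prodSwap) ψ :=
  mem_admissiblePairs_iff_le_cTransformMap.trans (gc_cTransformMap c φ (.toDual ψ))

theorem isConjugatePair_cTransformMap (ψ : C(Y, ℝ)) :
    IsConjugatePair c (cTransformMap (c.comp .prodSwap) ψ,
      cTransformMap c (cTransformMap (c.comp .prodSwap) ψ)) :=
  ⟨mem_admissiblePairs_iff_le_cTransformMap.2 le_rfl, fun _ => rfl, fun x =>
    (DFunLike.congr_fun ((gc_cTransformMap c).u_l_u_eq_u (.toDual ψ)) x).symm⟩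

theorem exists_isConjugatePair_ge {p : C(X, ℝ) × C(Y, ℝ)} (hp : p ∈ admissiblePairs c) :
    ∃ q, IsConjugatePair c q ∧ p ≤ q :=
  ⟨_, isConjugatePair_cTransformMap p.2, mem_admissiblePairs_iff_le_cTransformMap_prodSwap.1 hp,
    (gc_cTransformMap c).l_u_le (.toDual p.2)⟩

end CTransform

section DualProblem

variable {X Y : Type*} [TopologicalSpace X] [TopologicalSpace Y]

/-- The functions on `X` which vanish at `x₀` and have the modulus of continuity of the cost: the
compact set in which the dual problem is solved. -/
def normalizedPotentials [CompactSpace Y] (c : C(X × Y, ℝ)) (x₀ : X) : Set C(X, ℝ) :=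
  {φ | φ x₀ = 0 ∧ ∀ x x', dist (φ x) (φ x') ≤ dist (c.curry x) (c.curry x')}

theorem isCompact_normalizedPotentials [CompactSpace Y] (c : C(X × Y, ℝ)) (x₀ : X) :
    IsCompact (normalizedPotentials c x₀) :=
  isCompact_setOf_apply_eq_and_dist_le c.curry x₀ 0

variable [MeasurableSpace X] [MeasurableSpace Y] (μ : ProbabilityMeasure X)
  (ν : ProbabilityMeasure Y) (c : C(X × Y, ℝ))

/-- The value `D c` of the dual problem, as a function of the cost. -/
noncomputable def dualCost : ℝ :=
  sSup (dualValue μ ν '' admissiblePairs c)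

variable [CompactSpace X] [OpensMeasurableSpace X] [CompactSpace Y] [OpensMeasurableSpace Y]

theorem isBoundedLinearMap_dualValue : IsBoundedLinearMap ℝ (dualValue μ ν) :=
  ((isBoundedLinearMap_integral (μ : Measure X)).comp .fst).add
    ((isBoundedLinearMap_integral (ν : Measure Y)).comp .snd)

theorem monotone_dualValue : Monotone (dualValue μ ν) := fun _ _ hpq =>
  add_le_add
    (integral_mono (integrable_continuousMap _ _) (integrable_continuousMap _ _) hpq.1)
    (integral_mono (integrable_continuousMap _ _) (integrable_continuousMap _ _) hpq.2)

theorem exists_mem_normalizedPotentials_dualValue_le (x₀ : X) {p : C(X, ℝ) × C(Y, ℝ)}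
    (hp : p ∈ admissiblePairs c) :
    ∃ φ ∈ normalizedPotentials c x₀, dualValue μ ν p ≤ dualValue μ ν (φ, cTransformMap c φ) := by
  have : Nonempty X := μ.nonempty
  have : Nonempty Y := ν.nonempty
  obtain ⟨φ, ψ⟩ := p
  let φ' := cTransformMap (c.comp .prodSwap) ψ
  let a : ℝ := φ' x₀
  have hφ' : (φ', ψ) ∈ admissiblePairs c :=
    mem_admissiblePairs_iff_le_cTransformMap_prodSwap.2 le_rfl
  have hshift : (φ' - .const X a, ψ + .const Y a) ∈ admissiblePairs c := fun x y => by
    simpa [sub_add_add_cancel] using hφ' x y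
  refine ⟨φ' - .const X a, ⟨sub_self a, fun x x' => ?_⟩, ?_⟩
  · simpa using! dist_cTransformMap_apply_le (c.comp .prodSwap) ψ x x'
  calc dualValue μ ν (φ, ψ)
      ≤ dualValue μ ν (φ', ψ) :=
        monotone_dualValue μ ν ⟨mem_admissiblePairs_iff_le_cTransformMap_prodSwap.1 hp, le_rfl⟩
    _ = dualValue μ ν (φ' - .const X a, ψ + .const Y a) := by
        simp [dualValue, integral_add, integral_sub, integrable_continuousMap]
    _ ≤ dualValue μ ν (φ' - .const X a, cTransformMap c (φ' - .const X a)) :=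
        monotone_dualValue μ ν ⟨le_rfl, mem_admissiblePairs_iff_le_cTransformMap.1 hshift⟩

theorem exists_isConjugatePair_isGreatest :
    ∃ p, IsConjugatePair c p ∧
      IsGreatest (dualValue μ ν '' admissiblePairs c) (dualValue μ ν p) := by
  obtain ⟨x₀⟩ := μ.nonempty
  have : Nonempty X := ⟨x₀⟩
  have : Nonempty Y := ν.nonempty
  have hcont : Continuous fun φ => dualValue μ ν (φ, cTransformMap c φ) :=
    (isBoundedLinearMap_dualValue μ ν).continuous.comp
      (continuous_id.prodMk (lipschitzWith_one_cTransformMap c).continuous)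
  obtain ⟨φ, -, hmax⟩ := (isCompact_normalizedPotentials c x₀).exists_isMaxOn
    ⟨0, by simp [normalizedPotentials]⟩ hcont.continuousOn
  obtain ⟨p, hp, hle⟩ := exists_isConjugatePair_ge
    (mem_admissiblePairs_iff_le_cTransformMap.2 (le_refl (cTransformMap c φ)))
  refine ⟨p, hp, Set.mem_image_of_mem _ hp.1, ?_⟩
  rintro _ ⟨q, hq, rfl⟩
  obtain ⟨φ', hφ', hqφ'⟩ := exists_mem_normalizedPotentials_dualValue_le μ ν c x₀ hq
  exact (hqφ'.trans (hmax hφ')).trans (monotone_dualValue μ ν hle)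

theorem exists_isConjugatePair_dualValue_eq_dualCost :
    ∃ p, IsConjugatePair c p ∧ dualValue μ ν p = dualCost μ ν c :=
  let ⟨p, hp, hgreatest⟩ := exists_isConjugatePair_isGreatest μ ν c
  ⟨p, hp, hgreatest.csSup_eq.symm⟩

variable {c}

theorem dualValue_le_dualCost {p : C(X, ℝ) × C(Y, ℝ)} (hp : p ∈ admissiblePairs c) :
    dualValue μ ν p ≤ dualCost μ ν c :=
  let ⟨_, _, hgreatest⟩ := exists_isConjugatePair_isGreatest μ ν c
  le_csSup hgreatest.bddAbove (Set.mem_image_of_mem _ hp)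

variable (c)

theorem dualCost_add_dualCost_le (c' : C(X × Y, ℝ)) :
    dualCost μ ν c + dualCost μ ν c' ≤ dualCost μ ν (c + c') := by
  obtain ⟨p, hp, hpc⟩ := exists_isConjugatePair_dualValue_eq_dualCost μ ν c
  obtain ⟨q, hq, hqc⟩ := exists_isConjugatePair_dualValue_eq_dualCost μ ν c'
  rw [← hpc, ← hqc, ← (isBoundedLinearMap_dualValue μ ν).map_add]
  refine dualValue_le_dualCost μ ν fun x y => ?_
  simpa [add_add_add_comm] using add_le_add (hp.1 x y) (hq.1 x y)

theorem mul_dualCost_le_dualCost_smul {t : ℝ} (ht : 0 < t) :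
    t * dualCost μ ν c ≤ dualCost μ ν (t • c) := by
  obtain ⟨p, hp, hpc⟩ := exists_isConjugatePair_dualValue_eq_dualCost μ ν c
  rw [← hpc, ← smul_eq_mul, ← (isBoundedLinearMap_dualValue μ ν).map_smul]
  refine dualValue_le_dualCost μ ν fun x y => ?_
  simpa [mul_add] using mul_le_mul_of_nonneg_left (hp.1 x y) ht.le

theorem dualCost_smul {t : ℝ} (ht : 0 < t) : dualCost μ ν (t • c) = t * dualCost μ ν c := by
  refine le_antisymm ?_ (mul_dualCost_le_dualCost_smul μ ν c ht)
  have := mul_dualCost_le_dualCost_smul μ ν (t • c) (inv_pos.2 ht)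
  rwa [inv_smul_smul₀ ht.ne', inv_mul_le_iff₀ ht] at this

theorem exists_linearMap_ge_dualCost_apply_eq :
    ∃ Λ : C(X × Y, ℝ) →ₗ[ℝ] ℝ, (∀ f, dualCost μ ν f ≤ Λ f) ∧ Λ c = dualCost μ ν c := by
  obtain ⟨Λ, hΛ, hΛc⟩ := exists_linearMap_le_sublinear_apply_eq (fun f => -dualCost μ ν (-f))
    (fun t ht f => by rw [← smul_neg, dualCost_smul μ ν _ ht, mul_neg])
    (fun f g => by simpa only [neg_add] using neg_le_neg (dualCost_add_dualCost_le μ ν (-f) (-g)))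
    (-c)
  refine ⟨Λ, fun f => ?_, ?_⟩
  · simpa using hΛ (-f)
  · simpa using hΛc

end DualProblem

section Plans

variable {X Y : Type*} [TopologicalSpace X] [TopologicalSpace Y]

/-- The function `φ ⊕ ψ : (x, y) ↦ φ x + ψ y`, depending linearly on the pair `(φ, ψ)`. -/
def oplus : C(X, ℝ) × C(Y, ℝ) →ₗ[ℝ] C(X × Y, ℝ) :=
  (ContinuousMap.compRightAlgHom ℝ ℝ .fst).toLinearMap.coprod
    (ContinuousMap.compRightAlgHom ℝ ℝ .snd).toLinearMap

theorem oplus_apply (p : C(X, ℝ) × C(Y, ℝ)) (z : X × Y) : oplus p z = p.1 z.1 + p.2 z.2 := rfl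

variable [CompactSpace X] [MeasurableSpace X] [CompactSpace Y] [MeasurableSpace Y]

section OpensMeasurableSpace

variable [OpensMeasurableSpace X] [OpensMeasurableSpace Y]

theorem integrable_oplus (γ : Measure (X × Y)) [IsFiniteMeasure γ] (p : C(X, ℝ) × C(Y, ℝ)) :
    Integrable (oplus p) γ :=
  (integrable_continuousMap_comp γ p.1 measurable_fst).add
    (integrable_continuousMap_comp γ p.2 measurable_snd)

theorem integral_oplus (γ : Measure (X × Y)) [IsFiniteMeasure γ] (p : C(X, ℝ) × C(Y, ℝ)) :
    ∫ z, oplus p z ∂γ = (∫ x, p.1 x ∂γ.map Prod.fst) + ∫ y, p.2 y ∂γ.map Prod.snd := by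
  rw [integral_map measurable_fst.aemeasurable p.1.continuous.aestronglyMeasurable,
    integral_map measurable_snd.aemeasurable p.2.continuous.aestronglyMeasurable]
  exact integral_add (integrable_continuousMap_comp γ p.1 measurable_fst)
    (integrable_continuousMap_comp γ p.2 measurable_snd)

variable {μ : ProbabilityMeasure X} {ν : ProbabilityMeasure Y} {γ : ProbabilityMeasure (X × Y)}
  {p : C(X, ℝ) × C(Y, ℝ)} {c : X × Y → ℝ}

theorem integral_oplus_of_mem_plans (hγ : γ ∈ plans μ ν) (p : C(X, ℝ) × C(Y, ℝ)) :
    ∫ z, oplus p z ∂(γ : Measure (X × Y)) = dualValue μ ν p := by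
  rw [integral_oplus, hγ.1, hγ.2, dualValue]

theorem dualValue_le_planCost (hγ : γ ∈ plans μ ν) (hp : p ∈ admissiblePairs c)
    (hc : Integrable c (γ : Measure (X × Y))) : dualValue μ ν p ≤ planCost c γ := by
  rw [← integral_oplus_of_mem_plans hγ p]
  exact integral_mono (integrable_oplus _ p) hc fun z => hp z.1 z.2

theorem ae_add_eq_of_dualValue_eq_planCost (hγ : γ ∈ plans μ ν) (hp : p ∈ admissiblePairs c)
    (hc : Integrable c (γ : Measure (X × Y))) (h : dualValue μ ν p = planCost c γ) :
    ∀ᵐ z ∂(γ : Measure (X × Y)), p.1 z.1 + p.2 z.2 = c z := by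
  rw [← integral_oplus_of_mem_plans hγ p] at h
  exact (integral_eq_iff_of_ae_le (integrable_oplus _ p) hc (.of_forall fun z => hp z.1 z.2)).1 h

theorem apply_oplus_of_dualCost_le {Λ : C(X × Y, ℝ) →ₗ[ℝ] ℝ} (hΛ : ∀ f, dualCost μ ν f ≤ Λ f)
    (p : C(X, ℝ) × C(Y, ℝ)) : Λ (oplus p) = dualValue μ ν p := by
  have dualValue_le (q) : dualValue μ ν q ≤ Λ (oplus q) :=
    (dualValue_le_dualCost μ ν fun _ _ => le_rfl).trans (hΛ _)
  refine le_antisymm ?_ (dualValue_le p)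
  have := dualValue_le (-p)
  rw [(isBoundedLinearMap_dualValue μ ν).map_neg, map_neg, map_neg] at this
  exact neg_le_neg_iff.1 this

end OpensMeasurableSpace

variable [HasOuterApproxClosed X] [BorelSpace X] [HasOuterApproxClosed Y] [BorelSpace Y]
  (μ : ProbabilityMeasure X) (ν : ProbabilityMeasure Y)

variable {μ ν} in
theorem mem_plans_of_integral_oplus {γ : ProbabilityMeasure (X × Y)}
    (h : ∀ p, ∫ z, oplus p z ∂(γ : Measure (X × Y)) = dualValue μ ν p) : γ ∈ plans μ ν := by
  simp only [integral_oplus] at h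
  refine ⟨ext_of_forall_integral_eq_of_IsFiniteMeasure fun f => ?_,
    ext_of_forall_integral_eq_of_IsFiniteMeasure fun f => ?_⟩
  · simpa [dualValue] using h (f.toContinuousMap, 0)
  · simpa [dualValue] using h (0, f.toContinuousMap)

theorem exists_mem_plans_planCost_eq_dualCost [T2Space X] [T2Space Y]
    [SecondCountableTopologyEither X Y] (c : C(X × Y, ℝ)) :
    ∃ γ ∈ plans μ ν, planCost c γ = dualCost μ ν c := by
  obtain ⟨Λ, hΛ, hΛc⟩ := exists_linearMap_ge_dualCost_apply_eq μ ν c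
  have hΛ_oplus := apply_oplus_of_dualCost_le hΛ
  have map_nonneg (f : C(X × Y, ℝ)) (hf : 0 ≤ f) : 0 ≤ Λ f :=
    calc 0 = dualValue μ ν 0 := (isBoundedLinearMap_dualValue μ ν).map_zero.symm
      _ ≤ dualCost μ ν f := dualValue_le_dualCost μ ν fun x y => by simpa using hf (x, y)
      _ ≤ Λ f := hΛ f
  have map_one : Λ 1 = 1 :=
    calc Λ 1 = Λ (oplus (1, 0)) := congrArg Λ (by ext; simp [oplus_apply])
      _ = dualValue μ ν (1, 0) := hΛ_oplus _
      _ = 1 := by simp [dualValue]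
  obtain ⟨γ, hγ⟩ := exists_probabilityMeasure_integral_eq Λ map_nonneg map_one
  exact ⟨γ, mem_plans_of_integral_oplus fun p => (hγ _).trans (hΛ_oplus p), (hγ c).trans hΛc⟩

end Plans

end OptimalTransport

open OptimalTransport in
theorem mainTheorem1_general {X Y : Type*}
    [TopologicalSpace X] [CompactSpace X] [T2Space X] [HasOuterApproxClosed X]
    [MeasurableSpace X] [BorelSpace X]
    [TopologicalSpace Y] [CompactSpace Y] [T2Space Y] [HasOuterApproxClosed Y]
    [MeasurableSpace Y] [BorelSpace Y] [SecondCountableTopologyEither X Y]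
    (c : X × Y → ℝ) (hc : Continuous c) (μ : ProbabilityMeasure X) (ν : ProbabilityMeasure Y) :
    IsLeast (planCost c '' plans μ ν) (transportCost c μ ν) ∧
    IsLUB (dualValue μ ν '' admissiblePairs c) (transportCost c μ ν) ∧
    ∃ p : C(X, ℝ) × C(Y, ℝ), IsConjugatePair c p ∧
      dualValue μ ν p = sSup (dualValue μ ν '' admissiblePairs c) ∧
      ∀ γ : ProbabilityMeasure (X × Y), IsOptimalPlan c μ ν γ →
        ∀ᵐ z ∂(γ : Measure (X × Y)), p.1 z.1 + p.2 z.2 = c z := by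
  have hint (γ : ProbabilityMeasure (X × Y)) : Integrable c (γ : Measure (X × Y)) :=
    integrable_continuousMap _ ⟨c, hc⟩
  obtain ⟨p, hp, hgreatest⟩ := exists_isConjugatePair_isGreatest μ ν ⟨c, hc⟩
  obtain ⟨γ, hγ, hγ_cost⟩ := exists_mem_plans_planCost_eq_dualCost μ ν ⟨c, hc⟩
  have hleast : IsLeast (planCost c '' plans μ ν) (dualValue μ ν p) :=
    ⟨⟨γ, hγ, hγ_cost.trans hgreatest.csSup_eq⟩,
      Set.forall_mem_image.2 fun γ' hγ' => dualValue_le_planCost hγ' hp.1 (hint γ')⟩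
  have hT : transportCost c μ ν = dualValue μ ν p := hleast.csInf_eq
  refine ⟨hT ▸ hleast, hT ▸ hgreatest.isLUB, p, hp, hgreatest.csSup_eq.symm, fun γ' hγ' => ?_⟩
  exact ae_add_eq_of_dualValue_eq_planCost hγ'.1 hp.1 (hint γ') (hT.symm.trans hγ'.2.symm)

theorem mainTheorem1 {X Y : Type*}
    [MetricSpace X] [CompactSpace X] [MeasurableSpace X] [BorelSpace X]
    [MetricSpace Y] [CompactSpace Y] [MeasurableSpace Y] [BorelSpace Y]
    (c : X × Y → ℝ) (hc : Continuous c) (hc0 : ∀ p, 0 ≤ c p)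
    (μ : ProbabilityMeasure X) (ν : ProbabilityMeasure Y) :
    -- the infimum defining `T_c(μ, ν)` is a minimum
    IsLeast (OptimalTransport.planCost c '' OptimalTransport.plans μ ν)
      (OptimalTransport.transportCost c μ ν) ∧
    -- the duality formula: `T_c(μ, ν)` is the supremum of the dual problem
    IsLUB (OptimalTransport.dualValue μ ν '' OptimalTransport.admissiblePairs c)
      (OptimalTransport.transportCost c μ ν) ∧
    -- a conjugate pair attains the supremum and satisfies the extremality relation
    ∃ p : C(X, ℝ) × C(Y, ℝ), OptimalTransport.IsConjugatePair c p ∧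
      OptimalTransport.dualValue μ ν p =
        sSup (OptimalTransport.dualValue μ ν '' OptimalTransport.admissiblePairs c) ∧
      ∀ γ : ProbabilityMeasure (X × Y), OptimalTransport.IsOptimalPlan c μ ν γ →
        ∀ᵐ z ∂(γ : Measure (X × Y)), p.1 z.1 + p.2 z.2 = c z :=
  mainTheorem1_general c hc μ ν
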